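/- Let $\Omega$ be an extremally disconnected compact Hausdorff space, let $X$ be a real or complex Banach space, and let $\mathrm{WC}(\Omega,X)$ be the space of functions $f:\Omega\to X$ that are continuous for the weak topology of $X$, with the supremum norm. For a Banach space $E$, a point $x^*$ of the closed unit ball $E_1^*$ of $E^*$ is called a w$^*$-w point of continuity (w$^*$-w PC) if the identity map $(E_1^*,\mathrm{w}^*)\to(E_1^*,\mathrm{w})$ is continuous at $x^*$. For $\omega\in\Omega$ and $x^*\in X^*$ let $(\delta_\omega\otimes x^*)(f)=x^*(f(\omega))$ for $f\in \mathrm{WC}(\Omega,X)$. Let $N$ be a finite or countably infinite index set, let $\alpha_i\in(0,1]$ for $i\in N$ with $\sum_{i\in N}\alpha_i=1$, let $\omega_i$ $(i\in N)$ be pairwise distinct isolated points of $\Omega$, and let $x_i^*\in X_1^*$ be a w$^*$-w PC for each $i\in N$; if $X$ is reflexive, assume moreover that $\|x_i^*\|=1$ for every $i\in N$. Let $$\Lambda=\sum_{i\in N}\alpha_i\,\delta_{\omega_i}\otimes x_i^*\in \mathrm{WC}(\Omega,X)_1^*,$$ the series converging in norm. Then $\Lambda$ is a w$^*$-w PC of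 $\mathrm{WC}(\Omega,X)_1^*$. -/

import Mathlib

open scoped ENNReal

/-- The Banach space `X` is reflexive: the canonical embedding into the bidual is onto. -/
def IsReflexiveSpace (𝕜 X : Type*) [RCLike 𝕜] [NormedAddCommGroup X] [NormedSpace 𝕜 X] : Prop :=
  Function.Surjective (NormedSpace.inclusionInDoubleDual 𝕜 X)

/-- `x` lies in the closed unit ball of the dual of `E`, and the identity map from this ball with
the weak-star topology to this ball with the weak topology (the one induced by the bidual of `E`)
is continuous at `x`. -/
def IsWeakStarWeakPC {𝕜 E : Type*} [RCLike 𝕜] [NormedAddCommGroup E] [NormedSpace 𝕜 E]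
    (x : StrongDual 𝕜 E) : Prop :=
  ‖x‖ ≤ 1 ∧
    ContinuousWithinAt
      (fun y : WeakDual 𝕜 E => toWeakSpace 𝕜 (StrongDual 𝕜 E) (WeakDual.toStrongDual y))
      {y : WeakDual 𝕜 E | ‖WeakDual.toStrongDual y‖ ≤ 1}
      (StrongDual.toWeakDual x)

/-- The space of functions `Ω → X` that are continuous for the weak topology of `X`, with the
supremum norm, as a subspace of the space of all bounded functions. For compact `Ω` the
boundedness is automatic, see `WC.exists_of_continuous`. -/
def WC (𝕜 Ω X : Type*) [RCLike 𝕜] [TopologicalSpace Ω] [NormedAddCommGroup X] [NormedSpace 𝕜 X] :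
    Submodule 𝕜 (lp (fun _ : Ω => X) ∞) where
  carrier := {f | Continuous fun ω => toWeakSpace 𝕜 X (f ω)}
  add_mem' {f g} hf hg := by
    have h : Continuous fun ω => toWeakSpace 𝕜 X (f ω) + toWeakSpace 𝕜 X (g ω) := hf.add hg
    exact h
  zero_mem' := by
    have h : Continuous fun _ : Ω => (0 : WeakSpace 𝕜 X) := continuous_const
    exact h
  smul_mem' c f hf := by
    have h : Continuous fun ω => c • toWeakSpace 𝕜 X (f ω) := hf.const_smul c
    exact h

/-- Every weakly continuous function on a compact space is an element of `WC`. -/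
theorem WC.exists_of_continuous {𝕜 Ω X : Type*} [RCLike 𝕜] [TopologicalSpace Ω] [CompactSpace Ω]
    [NormedAddCommGroup X] [NormedSpace 𝕜 X] (f : Ω → X)
    (hf : Continuous fun ω => toWeakSpace 𝕜 X (f ω)) :
    ∃ F : WC 𝕜 Ω X, ∀ ω, (F : lp (fun _ : Ω => X) ∞) ω = f ω := by
  have hb : ∃ C, ∀ ω, ‖NormedSpace.inclusionInDoubleDual 𝕜 X (f ω)‖ ≤ C := by
    apply banach_steinhaus
    intro φ
    have hc : Continuous fun ω => φ (f ω) :=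
      (WeakBilin.eval_continuous (topDualPairing 𝕜 X).flip φ).comp hf
    obtain ⟨C, hC⟩ := (isCompact_range hc.norm).bddAbove
    exact ⟨C, fun ω => hC ⟨ω, rfl⟩⟩
  obtain ⟨C, hC⟩ := hb
  have hm : Memℓp f ∞ := by
    apply memℓp_infty
    refine ⟨C, ?_⟩
    rintro _ ⟨ω, rfl⟩
    have h := hC ω
    rwa [show ‖NormedSpace.inclusionInDoubleDual 𝕜 X (f ω)‖ = ‖f ω‖ from
      (NormedSpace.inclusionInDoubleDualLi 𝕜 (E := X)).norm_map (f ω)] at h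
  exact ⟨⟨⟨f, hm⟩, hf⟩, fun _ => rfl⟩

/-- The functional `δ_ω ⊗ φ` on `WC 𝕜 Ω X`, that is, `f ↦ φ (f ω)`. -/
noncomputable def deltaTensor {𝕜 Ω X : Type*} [RCLike 𝕜] [TopologicalSpace Ω]
    [NormedAddCommGroup X] [NormedSpace 𝕜 X] (ω : Ω) (φ : StrongDual 𝕜 X) :
    StrongDual 𝕜 (WC 𝕜 Ω X) :=
  φ.comp ((lp.evalCLM 𝕜 (fun _ : Ω => X) ∞ ω).comp (WC 𝕜 Ω X).subtypeL)

/-- The defining formula of `δ_ω ⊗ φ`. -/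
theorem deltaTensor_apply {𝕜 Ω X : Type*} [RCLike 𝕜] [TopologicalSpace Ω]
    [NormedAddCommGroup X] [NormedSpace 𝕜 X] (ω : Ω) (φ : StrongDual 𝕜 X) (f : WC 𝕜 Ω X) :
    deltaTensor ω φ f = φ ((f : lp (fun _ : Ω => X) ∞) ω) := rfl

open Filter Topology

/-! Restriction to isolated points makes the dual norm additive: for `S i L = L.comp (WC.single (ω
i) _)`, the sum of the `‖S i L‖` over a finite set plus the norm of the remainder is at most `‖L‖`
(`sum_norm_comp_single_add_norm_sub_le`). Every `x i` has norm one, by hypothesis or by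
`IsWeakStarWeakPC.norm_eq_one`, and `S i Λ = α i • x i`. Let `L → Λ` weak* in the unit ball. Lower
semicontinuity gives `liminf ‖S i L‖ ≥ α i`. As the `α i` already sum to 1, no norm is left over:
`‖S i L‖ → α i`, and the remainder is uniformly small. After rescaling, the PC property of `x i`
makes each `S i L` converge weakly, and finitely many coordinates suffice. -/

theorem mem_range_of_forall_norm_sub_lt {E F : Type*} [NormedAddCommGroup E]
    [NormedAddCommGroup F] [CompleteSpace E] {f : E → F} (hf : ∀ a b, ‖f a - f b‖ = ‖a - b‖)
    {y : F} (h : ∀ ε > 0, ∃ x, ‖y - f x‖ < ε) : y ∈ Set.range f := by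
  have hiso : Isometry f := Isometry.of_dist_eq fun a b => by simpa only [dist_eq_norm] using hf a b
  rw [← hiso.isClosedEmbedding.isClosed_range.closure_eq, Metric.mem_closure_range_iff]
  simpa only [dist_eq_norm] using h

/-- A functional that is small on the common kernel of finitely many functionals is close to their
span. -/
theorem StrongDual.exists_mem_span_norm_sub_le {𝕜 E : Type*} [RCLike 𝕜] [NormedAddCommGroup E]
    [NormedSpace 𝕜 E] (Φ : StrongDual 𝕜 E) {t : Type*} [Finite t] (L : t → StrongDual 𝕜 E)
    {ε : ℝ} (hε : 0 ≤ ε) (h : ∀ y, (∀ e, L e y = 0) → ‖y‖ ≤ 1 → ‖Φ y‖ ≤ ε) :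
    ∃ Ψ ∈ Submodule.span 𝕜 (Set.range L), ‖Φ - Ψ‖ ≤ ε := by
  let p : Submodule 𝕜 E := ⨅ e, LinearMap.ker (L e).toLinearMap
  have hnorm : ‖Φ.comp p.subtypeL‖ ≤ ε :=
    ContinuousLinearMap.opNorm_le_of_unit_norm hε
      fun y hy => h y (fun e => (Submodule.mem_iInf _).1 y.2 e) hy.le
  -- Hahn–Banach: `Φ - g` vanishes on the common kernel, so it lies in the span, and `g` is the
  -- error.
  obtain ⟨g, hg, hgn⟩ := exists_extension_norm_eq p (Φ.comp p.subtypeL)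
  have hspan : (Φ - g).toLinearMap ∈
      Submodule.span 𝕜 (Set.range fun e => (L e).toLinearMap) := by
    refine mem_span_of_iInf_ker_le_ker fun y hy => ?_
    have := hg ⟨y, hy⟩
    simp_all
  have hrange : (Set.range fun e => (L e).toLinearMap) =
      ContinuousLinearMap.coeLM 𝕜 '' Set.range L := by
    rw [← Set.range_comp]
    rfl
  rw [hrange, Submodule.span_image] at hspan
  obtain ⟨Ψ, hΨ, hΨg⟩ := hspan
  obtain rfl : Ψ = Φ - g := ContinuousLinearMap.coe_injective hΨg
  exact ⟨_, hΨ, by rw [sub_sub_cancel, hgn]; exact hnorm⟩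

/-- A linear functional that is continuous at `0` on the dual unit ball for convergence that is
eventually exact at each point comes from the space itself. -/
theorem mem_range_inclusionInDoubleDual {𝕜 X : Type*} [RCLike 𝕜] [NormedAddCommGroup X]
    [NormedSpace 𝕜 X] [CompleteSpace X] (Φ : StrongDual 𝕜 (StrongDual 𝕜 X))
    (h : Tendsto Φ ((⨅ e : X, 𝓟 {y : StrongDual 𝕜 X | y e = 0}) ⊓
      𝓟 {y : StrongDual 𝕜 X | ‖y‖ ≤ 1}) (𝓝 0)) :
    Φ ∈ Set.range (NormedSpace.inclusionInDoubleDual 𝕜 X) := by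
  refine mem_range_of_forall_norm_sub_lt (fun a b => ?_) fun ε hε => ?_
  · have hab := (NormedSpace.inclusionInDoubleDualLi 𝕜 (E := X)).norm_map (a - b)
    rw [LinearIsometry.map_sub] at hab
    exact hab
  have hmem := h (Metric.closedBall_mem_nhds (0 : 𝕜) (half_pos hε))
  rw [mem_map, mem_inf_principal] at hmem
  obtain ⟨t, ht, hsub⟩ :=
    (hasBasis_iInf_principal_finite fun e : X => {y : StrongDual 𝕜 X | y e = 0}).mem_iff.1 hmem
  have : Finite t := ht
  obtain ⟨Ψ, hΨ, hΦΨ⟩ := Φ.exists_mem_span_norm_sub_le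
    (fun e : t => NormedSpace.inclusionInDoubleDual 𝕜 X e.1) (half_pos hε).le fun y hy hy1 => by
      simpa using hsub (Set.mem_iInter₂.2 fun e he => hy ⟨e, he⟩) hy1
  have hle : Submodule.span 𝕜
      (Set.range fun e : t => NormedSpace.inclusionInDoubleDual 𝕜 X e.1) ≤
      LinearMap.range (NormedSpace.inclusionInDoubleDual 𝕜 X).toLinearMap := by
    rw [Submodule.span_le]
    rintro _ ⟨e, rfl⟩
    exact ⟨e, rfl⟩
  obtain ⟨z, rfl⟩ := hle hΨ
  exact ⟨z, hΦΨ.trans_lt (half_lt_self hε)⟩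

/-! ### Weak*-weak points of continuity in a general dual ball -/

section PC

variable {𝕜 E : Type*} [RCLike 𝕜] [NormedAddCommGroup E] [NormedSpace 𝕜 E]

theorem IsWeakStarWeakPC.tendsto_apply {x : StrongDual 𝕜 E} (hx : IsWeakStarWeakPC x)
    {A : Type*} {l : Filter A} {u : A → StrongDual 𝕜 E} (hu : ∀ᶠ a in l, ‖u a‖ ≤ 1)
    (hlim : ∀ e, Tendsto (fun a => u a e) l (𝓝 (x e))) (Φ : StrongDual 𝕜 (StrongDual 𝕜 E)) :
    Tendsto (fun a => Φ (u a)) l (𝓝 (Φ x)) := by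
  have h1 : Tendsto (fun a => StrongDual.toWeakDual (u a)) l
      (𝓝[{y : WeakDual 𝕜 E | ‖WeakDual.toStrongDual y‖ ≤ 1}] (StrongDual.toWeakDual x)) := by
    refine tendsto_nhdsWithin_iff.2 ⟨?_, hu⟩
    exact tendsto_iff_forall_eval_tendsto_topDualPairing.2 hlim
  have h2 := hx.2.tendsto.comp h1
  exact ((WeakBilin.eval_continuous (topDualPairing 𝕜 (StrongDual 𝕜 E)).flip Φ).tendsto _).comp h2

theorem isWeakStarWeakPC_of_tendsto {x : StrongDual 𝕜 E} (hx : ‖x‖ ≤ 1)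
    (h : ∀ (l : Filter (StrongDual 𝕜 E)), (∀ᶠ y in l, ‖y‖ ≤ 1) →
      (∀ e, Tendsto (fun y : StrongDual 𝕜 E => y e) l (𝓝 (x e))) →
      ∀ Φ : StrongDual 𝕜 (StrongDual 𝕜 E), Tendsto Φ l (𝓝 (Φ x))) :
    IsWeakStarWeakPC x := by
  refine ⟨hx, ?_⟩
  have hinj : Function.Injective (topDualPairing 𝕜 (StrongDual 𝕜 E)).flip := by
    intro a b hab
    exact (SeparatingDual.eq_iff_forall_dual_eq (R := 𝕜)).2 fun Φ => LinearMap.congr_fun hab Φ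
  refine (WeakBilin.tendsto_iff_forall_eval_tendsto _ hinj).2 fun Φ => ?_
  let l := map (WeakDual.toStrongDual : WeakDual 𝕜 E → StrongDual 𝕜 E)
    (𝓝[{y : WeakDual 𝕜 E | ‖WeakDual.toStrongDual y‖ ≤ 1}] (StrongDual.toWeakDual x))
  refine tendsto_map'_iff.1 (h l ?_ (fun e => ?_) Φ)
  · exact eventually_map.2 eventually_mem_nhdsWithin
  · exact tendsto_map'_iff.2
      (((WeakDual.eval_continuous e).tendsto (StrongDual.toWeakDual x)).mono_left
        nhdsWithin_le_nhds)

/-- In a nonreflexive Banach space every w*-w point of continuity of the dual ball has norm one. -/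
theorem IsWeakStarWeakPC.norm_eq_one [CompleteSpace E] {x : StrongDual 𝕜 E}
    (hx : IsWeakStarWeakPC x) (hE : ¬ IsReflexiveSpace 𝕜 E) : ‖x‖ = 1 := by
  by_contra hne
  have hlt : ‖x‖ < 1 := lt_of_le_of_ne hx.1 hne
  set r : ℝ := 1 - ‖x‖ with hr
  have hr0 : 0 < r := by rw [hr]; linarith
  have hr𝕜 : (r : 𝕜) ≠ 0 := by exact_mod_cast hr0.ne'
  refine hE fun Φ => mem_range_inclusionInDoubleDual Φ ?_
  set l := (⨅ e : E, 𝓟 {y : StrongDual 𝕜 E | y e = 0}) ⊓ 𝓟 {y : StrongDual 𝕜 E | ‖y‖ ≤ 1} with hl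
  -- The ball of radius `r` about `x` lies in the dual unit ball, so continuity at `x` transfers to
  -- continuity of `Φ` at 0.
  have h := hx.tendsto_apply (l := l) (u := fun y => x + (r : 𝕜) • y) ?_ ?_ Φ
  · have h2 := (h.sub_const (Φ x)).const_mul ((r : 𝕜)⁻¹)
    simpa [hr𝕜] using h2
  · have : ∀ᶠ y in l, ‖y‖ ≤ 1 := mem_inf_of_right (mem_principal_self _)
    filter_upwards [this] with y hy
    calc ‖x + (r : 𝕜) • y‖ ≤ ‖x‖ + r * ‖y‖ := by
          refine (norm_add_le _ _).trans_eq ?_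
          rw [norm_smul, RCLike.norm_ofReal, abs_of_pos hr0]
      _ ≤ 1 := by nlinarith
  · intro e
    have : ∀ᶠ y in l, y e = 0 :=
      mem_inf_of_left (mem_iInf_of_mem e (mem_principal_self _))
    refine tendsto_const_nhds.congr' ?_
    filter_upwards [this] with y hy
    simp [hy]

/-- Weak* lower semicontinuity of the norm. -/
theorem eventually_lt_norm_of_tendsto_apply {A : Type*} {l : Filter A} {u : A → StrongDual 𝕜 E}
    {x : StrongDual 𝕜 E} (hlim : ∀ e, Tendsto (fun a => u a e) l (𝓝 (x e))) {c : ℝ}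
    (hc : c < ‖x‖) : ∀ᶠ a in l, c < ‖u a‖ := by
  obtain ⟨e, he, hce⟩ := x.exists_lt_apply_of_lt_opNorm hc
  filter_upwards [(hlim e).norm.eventually_const_lt hce] with a ha
  exact ha.trans_le ((u a).unit_le_opNorm e he.le)

/-- Dividing by `max c ‖u a‖`, which tends to `c`, moves `u a` into the unit ball, where the PC
property of `x` applies. -/
theorem IsWeakStarWeakPC.tendsto_apply_smul {x : StrongDual 𝕜 E} (hx : IsWeakStarWeakPC x)
    {c : ℝ} (hc : 0 < c) {A : Type*} {l : Filter A} {u : A → StrongDual 𝕜 E}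
    (hu : ∀ b, c < b → ∀ᶠ a in l, ‖u a‖ < b)
    (hlim : ∀ e, Tendsto (fun a => u a e) l (𝓝 (((c : 𝕜) • x) e)))
    (Φ : StrongDual 𝕜 (StrongDual 𝕜 E)) :
    Tendsto (fun a => Φ (u a)) l (𝓝 (Φ ((c : 𝕜) • x))) := by
  let m : A → ℝ := fun a => max c ‖u a‖
  have hm0 : ∀ a, 0 < m a := fun a => hc.trans_le (le_max_left _ _)
  have hm𝕜 : ∀ a, (m a : 𝕜) ≠ 0 := fun a => by exact_mod_cast (hm0 a).ne'
  have hc𝕜 : (c : 𝕜) ≠ 0 := by exact_mod_cast hc.ne'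
  have hm : Tendsto m l (𝓝 c) := by
    refine tendsto_order.2 ⟨fun b hb => Eventually.of_forall fun a => hb.trans_le (le_max_left _ _),
      fun b hb => ?_⟩
    filter_upwards [hu b hb] with a ha using max_lt hb ha
  have hm' : Tendsto (fun a => (m a : 𝕜)) l (𝓝 (c : 𝕜)) :=
    (RCLike.continuous_ofReal.tendsto c).comp hm
  have h := hx.tendsto_apply (l := l) (u := fun a => (m a : 𝕜)⁻¹ • u a) ?_ ?_ Φ
  · have h2 := hm'.mul h
    simpa [hm𝕜] using h2
  · refine Eventually.of_forall fun a => ?_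
    rw [norm_smul, norm_inv, RCLike.norm_ofReal, abs_of_pos (hm0 a), inv_mul_le_one₀ (hm0 a)]
    exact le_max_right _ _
  · intro e
    have h2 := (hm'.inv₀ hc𝕜).mul (hlim e)
    simpa [hc𝕜] using h2

theorem tendsto_apply_of_approx {x : StrongDual 𝕜 E} {l : Filter (StrongDual 𝕜 E)}
    (Φ : StrongDual 𝕜 (StrongDual 𝕜 E))
    (h : ∀ η > 0, ∃ D : StrongDual 𝕜 E → StrongDual 𝕜 E,
      Tendsto (fun y => Φ (D y)) l (𝓝 (Φ (D x))) ∧ ‖x - D x‖ ≤ η ∧ ∀ᶠ y in l, ‖y - D y‖ ≤ η) :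
    Tendsto Φ l (𝓝 (Φ x)) := by
  rw [Metric.tendsto_nhds]
  intro ε hε
  have h0 := norm_nonneg Φ
  -- Each of the two approximation errors costs at most `ε / 4`; the `+ 1` covers `Φ = 0`.
  obtain ⟨D, hD, hDx, hDl⟩ := h (ε / (4 * (‖Φ‖ + 1))) (by positivity)
  have hΦ : ‖Φ‖ * (ε / (4 * (‖Φ‖ + 1))) ≤ ε / 4 := by
    rw [mul_div_assoc', div_le_div_iff₀ (by positivity) (by norm_num)]
    nlinarith
  filter_upwards [hDl, (Metric.tendsto_nhds.1 hD) (ε / 2) (half_pos hε)] with y hy1 hy2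
  have hsplit : Φ y - Φ x = Φ (y - D y) - Φ (x - D x) + (Φ (D y) - Φ (D x)) := by
    simp only [map_sub]
    ring
  have hy3 := (Φ.le_opNorm_of_le hy1).trans hΦ
  have hx3 := (Φ.le_opNorm_of_le hDx).trans hΦ
  rw [dist_eq_norm] at hy2 ⊢
  rw [hsplit]
  refine (norm_add_le _ _).trans_lt ?_
  linarith [norm_sub_le (Φ (y - D y)) (Φ (x - D x))]

theorem StrongDual.norm_le_of_hasSum_smul {ι : Type*} {f : ι → StrongDual 𝕜 E}
    {s : StrongDual 𝕜 E} {α : ι → ℝ} (h : HasSum (fun i => (α i : 𝕜) • f i) s) {c : ℝ}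
    (hα : HasSum α c) (hα0 : ∀ i, 0 ≤ α i) (hf : ∀ i, ‖f i‖ ≤ 1) : ‖s‖ ≤ c := by
  refine h.norm_le_of_bounded hα fun i => ?_
  rw [norm_smul, RCLike.norm_ofReal, abs_of_nonneg (hα0 i)]
  exact mul_le_of_le_one_right (hα0 i) (hf i)

theorem tendsto_apply_sum {A ι : Type*} {l : Filter A} (Φ : StrongDual 𝕜 (StrongDual 𝕜 E))
    (F : Finset ι) {u : ι → A → StrongDual 𝕜 E} {x : ι → StrongDual 𝕜 E}
    (h : ∀ i, Tendsto (fun a => Φ (u i a)) l (𝓝 (Φ (x i)))) :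
    Tendsto (fun a => Φ (∑ i ∈ F, u i a)) l (𝓝 (Φ (∑ i ∈ F, x i))) := by
  simp only [map_sum]
  exact tendsto_finsetSum _ fun i _ => h i

end PC

/-! ### Splitting functionals at isolated points -/

section Single

variable {𝕜 Ω X : Type*} [RCLike 𝕜] [TopologicalSpace Ω] [NormedAddCommGroup X] [NormedSpace 𝕜 X]

open Classical in
/-- For an isolated point `ω`, the map sending `e` to the function with value `e` at `ω` and `0`
elsewhere. -/
noncomputable def WC.single [T1Space Ω] (ω : Ω) (h : IsOpen ({ω} : Set Ω)) : X →L[𝕜] WC 𝕜 Ω X :=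
  LinearMap.mkContinuous
    ((lp.lsingle (𝕜 := 𝕜) (E := fun _ : Ω => X) ∞ ω).codRestrict (WC 𝕜 Ω X) fun e => by
      have hlc : IsLocallyConstant (Pi.single ω e : Ω → X) := by
        refine (IsLocallyConstant.iff_exists_open _).2 fun η => ?_
        by_cases hη : η = ω
        · exact ⟨{ω}, h, hη, fun y hy => by rw [hη, Set.mem_singleton_iff.1 hy]⟩
        · exact ⟨{ω}ᶜ, isOpen_compl_singleton, hη, fun y hy => by
            rw [Pi.single_eq_of_ne hη, Pi.single_eq_of_ne hy]⟩
      exact (hlc.comp (toWeakSpace 𝕜 X)).continuous) 1 fun e => by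
    rw [one_mul]
    exact (lp.norm_single (E := fun _ : Ω => X) ENNReal.zero_lt_top ω e).le

theorem WC.single_apply_self [T1Space Ω] (ω : Ω) (h : IsOpen ({ω} : Set Ω)) (e : X) :
    (WC.single (𝕜 := 𝕜) ω h e : lp (fun _ : Ω => X) ∞) ω = e := by
  classical
  exact Pi.single_eq_same (M := fun _ : Ω => X) ω e

theorem WC.single_apply_of_ne [T1Space Ω] {ω η : Ω} (h : IsOpen ({ω} : Set Ω)) (hne : η ≠ ω)
    (e : X) :
    (WC.single (𝕜 := 𝕜) ω h e : lp (fun _ : Ω => X) ∞) η = 0 := by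
  classical
  exact Pi.single_eq_of_ne (M := fun _ : Ω => X) hne e

theorem norm_deltaTensor_le (ω : Ω) (φ : StrongDual 𝕜 X) :
    ‖(deltaTensor ω φ : StrongDual 𝕜 (WC 𝕜 Ω X))‖ ≤ ‖φ‖ := by
  refine ContinuousLinearMap.opNorm_le_bound _ (norm_nonneg _) fun f => ?_
  rw [deltaTensor_apply]
  refine (φ.le_opNorm _).trans (mul_le_mul_of_nonneg_left ?_ (norm_nonneg _))
  exact lp.norm_apply_le_norm ENNReal.top_ne_zero (f : lp (fun _ : Ω => X) ∞) ω

/-- `deltaTensor ω` as a continuous linear map. -/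
noncomputable def deltaTensorCLM (𝕜 : Type*) {Ω : Type*} (X : Type*) [RCLike 𝕜]
    [TopologicalSpace Ω] [NormedAddCommGroup X] [NormedSpace 𝕜 X] (ω : Ω) :
    StrongDual 𝕜 X →L[𝕜] StrongDual 𝕜 (WC 𝕜 Ω X) :=
  ContinuousLinearMap.precomp 𝕜
    ((lp.evalCLM 𝕜 (fun _ : Ω => X) ∞ ω).comp (WC 𝕜 Ω X).subtypeL)

variable [T1Space Ω]

theorem deltaTensor_comp_single (ω : Ω) (h : IsOpen ({ω} : Set Ω)) (φ : StrongDual 𝕜 X) :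
    (deltaTensor ω φ).comp (WC.single ω h) = φ := by
  ext e
  rw [ContinuousLinearMap.comp_apply, deltaTensor_apply, WC.single_apply_self]

theorem deltaTensor_comp_single_of_ne {ω η : Ω} (h : IsOpen ({ω} : Set Ω)) (hne : η ≠ ω)
    (φ : StrongDual 𝕜 X) : (deltaTensor η φ).comp (WC.single ω h) = 0 := by
  ext e
  rw [ContinuousLinearMap.comp_apply, deltaTensor_apply, WC.single_apply_of_ne h hne, map_zero,
    zero_apply]

/-- Restriction to an isolated point is an M-projection, so its adjoint is an L-projection. -/
theorem norm_comp_single_add_norm_sub_le (ω : Ω) (h : IsOpen ({ω} : Set Ω))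
    (L : StrongDual 𝕜 (WC 𝕜 Ω X)) :
    ‖L.comp (WC.single ω h)‖ + ‖L - deltaTensor ω (L.comp (WC.single ω h))‖ ≤ ‖L‖ := by
  by_contra! hle
  set y := L.comp (WC.single ω h) with hy
  set R := L - deltaTensor ω y with hR
  obtain ⟨a, b, ha, hb, hab⟩ : ∃ a b, a < ‖y‖ ∧ b < ‖R‖ ∧ ‖L‖ < a + b :=
    ⟨‖y‖ - (‖y‖ + ‖R‖ - ‖L‖) / 3, ‖R‖ - (‖y‖ + ‖R‖ - ‖L‖) / 3,
      by linarith, by linarith, by linarith⟩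
  obtain ⟨e, he, hae⟩ := y.exists_lt_apply_of_lt_opNorm ha
  obtain ⟨f, hf, hbf⟩ := R.exists_lt_apply_of_lt_opNorm hb
  obtain ⟨s, hs, hse⟩ := RCLike.exists_norm_eq_mul_self (y e)
  obtain ⟨t, ht, htf⟩ := RCLike.exists_norm_eq_mul_self (R f)
  -- `g` is `s • e` at `ω` and `t • f` elsewhere: its sup norm is at most 1, yet `L` attains the sum
  -- of both values on it.
  let g : WC 𝕜 Ω X := WC.single ω h (s • e) +
    t • (f - WC.single ω h ((f : lp (fun _ : Ω => X) ∞) ω))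
  have hLg : L g = ((‖y e‖ + ‖R f‖ : ℝ) : 𝕜) := by
    rw [RCLike.ofReal_add, hse, htf, hR, sub_apply, deltaTensor_apply, hy]
    simp [g]
  have hg : ‖g‖ ≤ 1 := by
    refine lp.norm_le_of_forall_le zero_le_one fun η => ?_
    have hgη : (g : lp (fun _ : Ω => X) ∞) η =
        (WC.single (𝕜 := 𝕜) ω h (s • e) : lp (fun _ : Ω => X) ∞) η +
          t • ((f : lp (fun _ : Ω => X) ∞) η -
            (WC.single (𝕜 := 𝕜) ω h ((f : lp (fun _ : Ω => X) ∞) ω) :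
              lp (fun _ : Ω => X) ∞) η) := rfl
    change ‖(g : lp (fun _ : Ω => X) ∞) η‖ ≤ 1
    rw [hgη]
    by_cases hη : η = ω
    · subst hη
      rw [WC.single_apply_self, WC.single_apply_self, sub_self, smul_zero, add_zero, norm_smul,
        hs, one_mul]
      exact he.le
    · rw [WC.single_apply_of_ne h hη, WC.single_apply_of_ne h hη, zero_add, sub_zero, norm_smul,
        ht, one_mul]
      exact (lp.norm_apply_le_norm ENNReal.top_ne_zero (f : lp (fun _ : Ω => X) ∞) η).trans hf.le
  have h1 := L.unit_le_opNorm g hg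
  rw [hLg, RCLike.norm_ofReal, abs_of_nonneg (by positivity)] at h1
  linarith

/-- The points are split off one at a time; removing the others does not change the component at `ω
j`. -/
theorem sum_norm_comp_single_add_norm_sub_le {ι : Type*} {ω : ι → Ω} (hω : Function.Injective ω)
    (h : ∀ i, IsOpen ({ω i} : Set Ω)) (L : StrongDual 𝕜 (WC 𝕜 Ω X)) (F : Finset ι) :
    ∑ i ∈ F, ‖L.comp (WC.single (ω i) (h i))‖ +
      ‖L - ∑ i ∈ F, deltaTensor (ω i) (L.comp (WC.single (ω i) (h i)))‖ ≤ ‖L‖ := by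
  classical
  induction F using Finset.induction_on with
  | empty => simp
  | insert j F hj ih =>
    have h1 := norm_comp_single_add_norm_sub_le (ω j) (h j)
      (L - ∑ i ∈ F, deltaTensor (ω i) (L.comp (WC.single (ω i) (h i))))
    have h2 : (L - ∑ i ∈ F, deltaTensor (ω i) (L.comp (WC.single (ω i) (h i)))).comp
        (WC.single (ω j) (h j)) = L.comp (WC.single (ω j) (h j)) := by
      rw [ContinuousLinearMap.sub_comp, ContinuousLinearMap.finsetSum_comp,
        Finset.sum_eq_zero, sub_zero]
      intro i hi
      exact deltaTensor_comp_single_of_ne _ (hω.ne (ne_of_mem_of_not_mem hi hj)) _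
    rw [h2] at h1
    rw [Finset.sum_insert hj, Finset.sum_insert hj, add_comm (deltaTensor _ _), ← sub_sub]
    linarith

end Single

/-! ### The main theorem -/

theorem theorem4p2 {𝕜 Ω X : Type*} [RCLike 𝕜]
    [TopologicalSpace Ω] [CompactSpace Ω] [T2Space Ω] [ExtremallyDisconnected Ω]
    [NormedAddCommGroup X] [NormedSpace 𝕜 X] [CompleteSpace X]
    {ι : Type*} [Countable ι]
    (α : ι → ℝ) (hα : ∀ i, α i ∈ Set.Ioc (0 : ℝ) 1) (hsum : HasSum α 1)
    (ω : ι → Ω) (hω : Function.Injective ω) (hisol : ∀ i, IsOpen ({ω i} : Set Ω))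
    (x : ι → StrongDual 𝕜 X) (hx : ∀ i, IsWeakStarWeakPC (x i))
    (hnorm : IsReflexiveSpace 𝕜 X → ∀ i, ‖x i‖ = 1)
    (Λ : StrongDual 𝕜 (WC 𝕜 Ω X))
    (hΛ : HasSum (fun i => (α i : 𝕜) • deltaTensor (ω i) (x i)) Λ) :
    IsWeakStarWeakPC Λ := by
  classical
  have hx1 : ∀ i, ‖x i‖ = 1 := fun i => by
    by_cases hX : IsReflexiveSpace 𝕜 X
    · exact hnorm hX i
    · exact (hx i).norm_eq_one hX
  have hΛ1 : ‖Λ‖ ≤ 1 := by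
    refine StrongDual.norm_le_of_hasSum_smul hΛ hsum (fun i => (hα i).1.le) fun i => ?_
    exact (norm_deltaTensor_le (ω i) (x i)).trans_eq (hx1 i)
  let S : ι → StrongDual 𝕜 (WC 𝕜 Ω X) → StrongDual 𝕜 X := fun i L =>
    L.comp (WC.single (ω i) (hisol i))
  have hSΛ : ∀ i, S i Λ = (α i : 𝕜) • x i := by
    intro i
    have h1 : HasSum (fun j => S i ((α j : 𝕜) • deltaTensor (ω j) (x j))) (S i Λ) :=
      hΛ.mapL (ContinuousLinearMap.precomp 𝕜 (WC.single (ω i) (hisol i)))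
    have h2 := hasSum_single (f := fun j => S i ((α j : 𝕜) • deltaTensor (ω j) (x j))) i
      fun j hj => by
        ext e
        change (α j : 𝕜) • ((deltaTensor (ω j) (x j)).comp (WC.single (ω i) (hisol i))) e = 0
        rw [deltaTensor_comp_single_of_ne _ (hω.ne hj), zero_apply, smul_zero]
    rw [h1.unique h2]
    simp only [S]
    rw [ContinuousLinearMap.smul_comp, deltaTensor_comp_single]
  refine isWeakStarWeakPC_of_tendsto hΛ1 fun l hl1 hl Φ => ?_
  have hSlim : ∀ i e, Tendsto (fun L => S i L e) l (𝓝 (((α i : 𝕜) • x i) e)) := by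
    intro i e
    rw [← hSΛ]
    exact hl _
  have hlow : ∀ (F : Finset ι) (ε : ℝ), 0 < ε →
      ∀ᶠ L in l, ∑ i ∈ F, α i - ε ≤ ∑ i ∈ F, ‖S i L‖ := by
    intro F ε hε
    have hδ : 0 < ε / (F.card + 1) := by positivity
    have h1 : ∀ᶠ L in l, ∀ i ∈ F, α i - ε / (F.card + 1) < ‖S i L‖ := by
      refine (Finset.eventually_all F).2 fun i _ =>
        eventually_lt_norm_of_tendsto_apply (hSlim i) ?_
      rw [norm_smul, RCLike.norm_ofReal, abs_of_pos (hα i).1, hx1]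
      linarith
    filter_upwards [h1] with L hL
    have h2 := Finset.sum_le_sum fun i hi => (hL i hi).le
    rw [Finset.sum_sub_distrib, Finset.sum_const, nsmul_eq_mul] at h2
    have h3 : (F.card : ℝ) * (ε / (F.card + 1)) ≤ ε := by
      rw [mul_div_assoc', div_le_iff₀ (by positivity)]
      nlinarith
    linarith
  have hbig : ∀ ε : ℝ, 0 < ε → ∃ F₀ : Finset ι, ∀ F, F₀ ⊆ F → 1 - ε < ∑ i ∈ F, α i :=
    fun ε hε => eventually_atTop.1 (Tendsto.eventually_const_lt (sub_lt_self 1 hε) hsum)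
  -- The other coordinates use up nearly `1 - α i` of a total of at most 1. One third of `b - α i`
  -- pays for truncating the sum, another for `hlow`.
  have hup : ∀ i b, α i < b → ∀ᶠ L in l, ‖S i L‖ < b := by
    intro i b hb
    obtain ⟨F₀, hF₀⟩ := hbig ((b - α i) / 3) (by linarith)
    have hF := hF₀ (insert i F₀) (Finset.subset_insert _ _)
    have hi := Finset.mem_insert_self i F₀
    filter_upwards [hlow ((insert i F₀).erase i) ((b - α i) / 3) (by linarith), hl1] with L hL hL1
    have h1 := sum_norm_comp_single_add_norm_sub_le hω hisol L (insert i F₀)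
    have h2 := Finset.add_sum_erase _ (fun i => ‖S i L‖) hi
    have h3 := Finset.add_sum_erase _ α hi
    have h4 := (le_add_of_nonneg_right (ContinuousLinearMap.opNorm_nonneg _)).trans h1
    change ∑ i ∈ insert i F₀, ‖S i L‖ ≤ ‖L‖ at h4
    linarith
  have hterm : ∀ i, Tendsto (fun L => Φ (deltaTensor (ω i) (S i L))) l
      (𝓝 (Φ (deltaTensor (ω i) (S i Λ)))) := by
    intro i
    rw [hSΛ]
    exact (hx i).tendsto_apply_smul (hα i).1 (hup i) (hSlim i)
      (Φ.comp (deltaTensorCLM 𝕜 X (ω i)))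
  refine tendsto_apply_of_approx Φ fun η hη => ?_
  -- `F` misses less than `η / 2` of the mass; for `L` near `Λ`, `hlow` loses at most another `η /
  -- 2`, so `hrest` bounds both remainders by `η`.
  obtain ⟨F, hF⟩ := hbig (η / 2) (half_pos hη)
  specialize hF F subset_rfl
  have hrest : ∀ L, ∑ i ∈ F, ‖S i L‖ + ‖L - ∑ i ∈ F, deltaTensor (ω i) (S i L)‖ ≤ ‖L‖ :=
    fun L => sum_norm_comp_single_add_norm_sub_le hω hisol L F
  refine ⟨fun L => ∑ i ∈ F, deltaTensor (ω i) (S i L), ?_, ?_, ?_⟩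
  · exact tendsto_apply_sum Φ F hterm
  · have h1 := hrest Λ
    have h2 : ∑ i ∈ F, ‖S i Λ‖ = ∑ i ∈ F, α i := Finset.sum_congr rfl fun i _ => by
      rw [hSΛ, norm_smul, RCLike.norm_ofReal, abs_of_pos (hα i).1, hx1, mul_one]
    linarith
  · filter_upwards [hl1, hlow F (η / 2) (half_pos hη)] with L hL1 hL2
    have := hrest L
    linarith
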